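/- For $\alpha\in(0,1)$ and $n\in\mathbb{N}$, let $N_\alpha(n)$ denote the maximum number of equiangular lines in $\mathbb{R}^n$ with angle $\arccos\alpha$, that is, the maximum cardinality of a family of lines through the origin of the Euclidean space $\mathbb{R}^n$ such that any two distinct lines of the family form the angle $\arccos\alpha$. Theorem. Let $\alpha\in(0,1)$ and $\lambda := \frac{1-\alpha}{2\alpha}$, and suppose that $\lambda\ge 2$. Then the maximum $N_\alpha(n)$ exists for every $n$, and $$N_\alpha(n)\le\left(1+\frac14+\frac1{\lambda^2}+o_\alpha(1)\right)n,$$ where $o_\alpha(1)$ is a quantity depending only on $\alpha$ and $n$ that tends to $0$ as $n\to\infty$ with $\alpha$ fixed. In particular, $$N_{1/7}(n)\le\left(\frac43+\frac1{36}+o(1)\right)n\qquad(n\to\infty).$$ -/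

import Mathlib

noncomputable section

/-- The angle, in `[0, π / 2]`, between two lines through the origin of a real inner product space
(points of the projectivization): the smaller of the two angles made by direction vectors.
It does not depend on the chosen direction vectors, see `lineAngle_mk`. -/
def lineAngle {E : Type*} [NormedAddCommGroup E] [InnerProductSpace ℝ E]
    (L M : Projectivization ℝ E) : ℝ :=
  min (InnerProductGeometry.angle L.rep M.rep) (Real.pi - InnerProductGeometry.angle L.rep M.rep)

/-- The angle between two lines may be computed from any direction vectors. -/
theorem lineAngle_mk {E : Type*} [NormedAddCommGroup E] [InnerProductSpace ℝ E]
    (u v : E) (hu : u ≠ 0) (hv : v ≠ 0) :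
    lineAngle (Projectivization.mk ℝ u hu) (Projectivization.mk ℝ v hv) =
      min (InnerProductGeometry.angle u v) (Real.pi - InnerProductGeometry.angle u v) := by
  obtain ⟨a, ha⟩ := Projectivization.exists_smul_eq_mk_rep ℝ u hu
  obtain ⟨b, hb⟩ := Projectivization.exists_smul_eq_mk_rep ℝ v hv
  unfold lineAngle
  rw [← ha, ← hb, Units.smul_def, Units.smul_def]
  rcases lt_or_gt_of_ne a.ne_zero with h | h <;> rcases lt_or_gt_of_ne b.ne_zero with h' | h' <;>
    simp [InnerProductGeometry.angle_smul_left_of_pos, InnerProductGeometry.angle_smul_left_of_neg,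
      InnerProductGeometry.angle_smul_right_of_pos, InnerProductGeometry.angle_smul_right_of_neg,
      InnerProductGeometry.angle_neg_left, InnerProductGeometry.angle_neg_right, h, h', min_comm]

/-- A set of lines through the origin in `ℝⁿ` is equiangular with angle `arccos α` if any two
distinct lines in it make the angle `arccos α`. -/
def IsEquiangular (α : ℝ) {n : ℕ} (S : Set (Projectivization ℝ (EuclideanSpace ℝ (Fin n)))) :
    Prop :=
  S.Pairwise fun L M => lineAngle L M = Real.arccos α

/-- The possible cardinalities of finite families of equiangular lines in `ℝⁿ` with angle
`arccos α`. -/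
def equiangularSizes (α : ℝ) (n : ℕ) : Set ℕ :=
  {k | ∃ S : Finset (Projectivization ℝ (EuclideanSpace ℝ (Fin n))),
    IsEquiangular α (S : Set (Projectivization ℝ (EuclideanSpace ℝ (Fin n)))) ∧ S.card = k}

/-- `N_α(n)`: the maximum number of equiangular lines in `ℝⁿ` with angle `arccos α`. -/
def maxEquiangular (α : ℝ) (n : ℕ) : ℕ :=
  sSup (equiangularSizes α n)

end

/-! Put `μ = λ + 1 = (1 + α) / (2α)`. Unit vectors along the lines have Gram matrix `(1 + α) I + α J
- 2α Q`, where `Q` is the graph of negative inner products with a loop at every vertex. On vectors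
of coordinate sum zero the `J` term vanishes, so positivity of the Gram matrix bounds the form of
`Q` by `μ`, and linear relations among the vectors are eigenvectors of `Q` for `μ`. In dimension `n`
the relations of sum zero have codimension at most `n + 1`. If they have dimension at most `(1/μ +
o(1)) k` for `k` lines, then `k ≤ (1 + 1/λ + o(1)) n`, and `1/λ ≤ 1/4 + 1/λ²` by AM-GM.

Switching (replacing some vectors by their negatives) bounds the degrees of `Q` in terms of `α`:
`exists_switching`, based on Ramsey's theorem and a large subfamily with positive inner products.

The multiplicity bound is `IsLoopedAdj.finrank_le_aux`. With `m < μ ≤ m + 1`, eigenvectors vanish on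
components of at most `m` points. The other vertices have balls of radius `m` with at least `m + 1`
points, so a maximal packing of such balls has at most `|V| / μ` centres, and these form a net `U`
at distance `2m`. Require the eigenvectors to vanish on `U` and on the boundedly many vertices whose
large balls have top eigenvalue above `μ`. Each block of `2m` steps of the graph with these vertices
deleted loses a fixed proportion of the squared norm allowed by `μ` (`deleteVerts_sq_le`), so after
many blocks the surviving eigenspace has dimension at most `ε |V|` (`finrank_mul_sq_le`). -/

noncomputable section

/-! ### Walks and balls in looped graphs -/

/-- Symmetric matrices with entries `0` and `1` and unit diagonal: adjacency matrices of graphs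
with a loop at every vertex. -/
structure IsLoopedAdj {V : Type*} (Q : Matrix V V ℝ) : Prop where
  symm : Q.IsSymm
  entry : ∀ i j, Q i j = 0 ∨ Q i j = 1
  diag : ∀ i, Q i i = 1

/-- The vertices joined to `v` by a walk of length `k`. -/
def walkBall {V : Type*} [Fintype V] [DecidableEq V] (Q : Matrix V V ℝ) (v : V) (k : ℕ) :
    Finset V := by
  classical exact Finset.univ.filter fun u => (Q ^ k) v u ≠ 0

namespace IsLoopedAdj

open Matrix Finset

theorem nonneg {V : Type*} {Q : Matrix V V ℝ} (hQ : IsLoopedAdj Q) (i j : V) : 0 ≤ Q i j := by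
  rcases hQ.entry i j with h | h <;> simp [h]

/-- An eigenvector vanishes on a union of components with fewer points than the eigenvalue. -/
theorem eigenvector_eq_zero {V : Type*} [Fintype V] {Q : Matrix V V ℝ} (hQ : IsLoopedAdj Q) {μ : ℝ} {f : V → ℝ} (hf : Q *ᵥ f = μ • f)
    {C : Finset V} (hC : (C.card : ℝ) < μ) (hcl : ∀ u ∈ C, ∀ w, Q u w ≠ 0 → w ∈ C)
    {v : V} (hv : v ∈ C) : f v = 0 := by
  -- Maximum principle: where `|f|` is largest on `C`, `μ |f u|` is bounded by at most `|C| < μ`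
  -- terms, each at most `|f u|`.
  obtain ⟨u, hu, hmax⟩ := exists_max_image C (fun w => |f w|) ⟨v, hv⟩
  have h1 : μ * f u = ∑ w ∈ C, Q u w * f w := by
    have := congrFun hf u
    simp only [Matrix.mulVec, dotProduct, Pi.smul_apply, smul_eq_mul] at this
    rw [← this]
    refine (sum_subset (subset_univ C) fun w _ hw => ?_).symm
    have : Q u w = 0 := by by_contra h; exact hw (hcl u hu w h)
    simp [this]
  have h2 : |μ * f u| ≤ C.card * |f u| := by
    rw [h1]
    refine (abs_sum_le_sum_abs _ _).trans ?_
    rw [← nsmul_eq_mul]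
    refine sum_le_card_nsmul _ _ _ fun w hw => ?_
    rw [abs_mul]
    rcases hQ.entry u w with h | h
    · simp [h]
    · simpa [h] using hmax w hw
  have hμ : 0 ≤ μ := (Nat.cast_nonneg C.card).trans hC.le
  rw [abs_mul, abs_of_nonneg hμ] at h2
  have h3 : |f u| = 0 := by
    by_contra h
    have : 0 < |f u| := lt_of_le_of_ne (abs_nonneg _) (Ne.symm h)
    nlinarith
  have := hmax v hv
  rw [h3] at this
  exact abs_eq_zero.1 (le_antisymm this (abs_nonneg _))

variable {V : Type*} [Fintype V] [DecidableEq V] {Q : Matrix V V ℝ}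

/-- Entries count walks. The gap between 0 and 1 makes every reachable vertex carry weight at least
1. -/
theorem pow_entry (hQ : IsLoopedAdj Q) (k : ℕ) (i j : V) :
    (Q ^ k) i j = 0 ∨ 1 ≤ (Q ^ k) i j := by
  induction k generalizing i j with
  | zero => by_cases h : i = j <;> simp [h]
  | succ k ih =>
    rw [pow_succ, Matrix.mul_apply]
    have hnn : ∀ l ∈ (univ : Finset V), 0 ≤ (Q ^ k) i l * Q l j := fun l _ =>
      mul_nonneg (by rcases ih i l with h | h <;> linarith) (hQ.nonneg l j)
    by_cases h : ∃ l, (Q ^ k) i l * Q l j ≠ 0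
    · obtain ⟨l, hl⟩ := h
      right
      refine le_trans ?_ (single_le_sum hnn (mem_univ l))
      rcases ih i l with h1 | h1
      · simp [h1] at hl
      · rcases hQ.entry l j with h2 | h2
        · simp [h2] at hl
        · simpa [h2] using h1
    · push Not at h
      left
      exact sum_eq_zero fun l _ => h l

theorem pow_nonneg (hQ : IsLoopedAdj Q) (k : ℕ) (i j : V) : 0 ≤ (Q ^ k) i j := by
  rcases hQ.pow_entry k i j with h | h <;> linarith

theorem mem_ball {v u : V} {k : ℕ} : u ∈ walkBall Q v k ↔ (Q ^ k) v u ≠ 0 := by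
  simp [walkBall]

theorem one_le_of_mem (hQ : IsLoopedAdj Q) {v u : V} {k : ℕ} (h : u ∈ walkBall Q v k) :
    1 ≤ (Q ^ k) v u := (hQ.pow_entry k v u).resolve_left (mem_ball.1 h)

theorem ball_comm (hQ : IsLoopedAdj Q) {v u : V} {k : ℕ} (h : u ∈ walkBall Q v k) :
    v ∈ walkBall Q u k := by
  rw [mem_ball] at *
  rwa [← (hQ.symm.pow k).apply]

theorem ball_trans (hQ : IsLoopedAdj Q) {v u w : V} {a b : ℕ} (h : u ∈ walkBall Q v a)
    (h' : w ∈ walkBall Q u b) : w ∈ walkBall Q v (a + b) := by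
  rw [mem_ball, pow_add, Matrix.mul_apply]
  have h1 := hQ.one_le_of_mem h
  have h2 := hQ.one_le_of_mem h'
  have : (Q ^ a) v u * (Q ^ b) u w ≤ ∑ l, (Q ^ a) v l * (Q ^ b) l w := single_le_sum
    (fun l _ => mul_nonneg (hQ.pow_nonneg a v l) (hQ.pow_nonneg b l w)) (mem_univ u)
  nlinarith

theorem mem_ball_one {v u : V} : u ∈ walkBall Q v 1 ↔ Q v u ≠ 0 := by
  rw [mem_ball, pow_one]

theorem self_mem_ball (hQ : IsLoopedAdj Q) (v : V) (k : ℕ) : v ∈ walkBall Q v k := by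
  induction k with
  | zero => simp [mem_ball]
  | succ k ih => exact hQ.ball_trans ih (mem_ball_one.2 (by simp [hQ.diag]))

theorem ball_mono (hQ : IsLoopedAdj Q) (v : V) {a b : ℕ} (h : a ≤ b) :
    walkBall Q v a ⊆ walkBall Q v b := fun u hu => by
  have := hQ.ball_trans hu (hQ.self_mem_ball u (b - a))
  rwa [Nat.add_sub_cancel' h] at this

theorem exists_of_mem_ball_succ {v w : V} {k : ℕ} (h : w ∈ walkBall Q v (k + 1)) :
    ∃ u ∈ walkBall Q v k, Q u w ≠ 0 := by
  rw [mem_ball, pow_succ, Matrix.mul_apply] at h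
  obtain ⟨u, -, hu⟩ := exists_ne_zero_of_sum_ne_zero h
  exact ⟨u, mem_ball.2 (left_ne_zero_of_mul hu), right_ne_zero_of_mul hu⟩

theorem card_ball_le (hQ : IsLoopedAdj Q) {D : ℕ} (hD : ∀ i, ∑ j, Q i j ≤ D) (v : V) (k : ℕ) :
    (walkBall Q v k).card ≤ D ^ k := by
  have hs : ∀ k, ∑ u, (Q ^ k) v u ≤ (D : ℝ) ^ k := by
    intro k
    induction k with
    | zero => simp [Matrix.one_apply]
    | succ k ih =>
      simp only [pow_succ, Matrix.mul_apply]
      rw [sum_comm]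
      calc ∑ l, ∑ u, (Q ^ k) v l * Q l u ≤ ∑ l, (Q ^ k) v l * D := by
            refine sum_le_sum fun l _ => ?_
            rw [← mul_sum]
            exact mul_le_mul_of_nonneg_left (hD l) (hQ.pow_nonneg k v l)
        _ ≤ _ := by
            rw [← sum_mul]
            exact mul_le_mul_of_nonneg_right ih (Nat.cast_nonneg D)
  have : ((walkBall Q v k).card : ℝ) ≤ (D : ℝ) ^ k := by
    refine le_trans ?_ (hs k)
    calc ((walkBall Q v k).card : ℝ) = ∑ u ∈ walkBall Q v k, (1 : ℝ) := by simp
      _ ≤ ∑ u ∈ walkBall Q v k, (Q ^ k) v u := sum_le_sum fun u hu => hQ.one_le_of_mem hu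
      _ ≤ _ := sum_le_sum_of_subset_of_nonneg (subset_univ _) fun u _ _ => hQ.pow_nonneg k v u
  exact_mod_cast this

/-- A ball of radius `k` either has more than `k` points or is a union of components. -/
theorem ball_large_or_closed (hQ : IsLoopedAdj Q) (v : V) (k : ℕ) :
    k + 1 ≤ (walkBall Q v k).card ∨ ∀ u ∈ walkBall Q v k, ∀ w, Q u w ≠ 0 → w ∈ walkBall Q v k := by
  induction k with
  | zero => left; simpa using card_pos.2 ⟨v, hQ.self_mem_ball v 0⟩
  | succ k ih =>
    have hsub := hQ.ball_mono v (k.le_add_right 1)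
    -- Balls gain a point at every step until the first step at which they stop growing, and are
    -- closed from then on.
    by_cases heq : walkBall Q v (k + 1) ⊆ walkBall Q v k
    · right
      intro u hu w hw
      exact hQ.ball_trans (heq hu) (mem_ball_one.2 hw)
    · rcases ih with h | h
      · left
        have := card_lt_card (ssubset_of_subset_not_subset hsub heq)
        omega
      · exfalso
        refine heq fun w hw => ?_
        obtain ⟨u, hu, huw⟩ := exists_of_mem_ball_succ hw
        exact h u hu w huw

end IsLoopedAdj

/-! ### Dimension bound by double counting -/

open Matrix Finset in
/-- If each coordinate functional on a subspace `K` of `ℝ^V`, scaled by `a`, is the inner product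
with a vector of squared norm at most `b`, then `dim K * a ^ 2 ≤ |V| * b`. -/
theorem finrank_mul_sq_le {V : Type*} [Fintype V] (K : Submodule ℝ (V → ℝ)) (a b : ℝ)
    (x : V → V → ℝ) (hx : ∀ f ∈ K, ∀ v, f v * a = f ⬝ᵥ x v) (hb : ∀ v, x v ⬝ᵥ x v ≤ b) :
    (Module.finrank ℝ K : ℝ) * a ^ 2 ≤ Fintype.card V * b := by
  classical
  let e : EuclideanSpace ℝ V ≃ₗ[ℝ] (V → ℝ) := WithLp.linearEquiv 2 ℝ (V → ℝ)
  let K' : Submodule ℝ (EuclideanSpace ℝ V) := K.comap e.toLinearMap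
  have hrank : Module.finrank ℝ K' = Module.finrank ℝ K :=
    (e.ofSubmodule' K).finrank_eq
  let o := stdOrthonormalBasis ℝ K'
  have ho : Orthonormal ℝ fun i => (o i : EuclideanSpace ℝ V) :=
    o.orthonormal.comp_linearIsometry K'.subtypeₗᵢ
  have hin : ∀ f g : EuclideanSpace ℝ V, inner ℝ f g = (e f) ⬝ᵥ (e g) := by
    intro f g
    simp [e, PiLp.inner_apply, dotProduct, mul_comm]
  -- Bessel's inequality at each `v`, for an orthonormal basis of `K`; summing over `v` counts the
  -- basis vectors with weight `a ^ 2`.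
  have h1 : ∀ v, ∑ i, (e (o i) v * a) ^ 2 ≤ b := by
    intro v
    have hB := ho.sum_inner_products_le (s := univ) (e.symm (x v))
    refine le_trans (le_of_eq ?_) (hB.trans ?_)
    · refine sum_congr rfl fun i _ => ?_
      rw [show e (o i) v * a = e (o i) ⬝ᵥ x v from hx _ (o i).2 v, hin, LinearEquiv.apply_symm_apply, Real.norm_eq_abs, sq_abs]
    · rw [← real_inner_self_eq_norm_sq, hin, LinearEquiv.apply_symm_apply]
      exact hb v
  have h2 : ∀ i, ∑ v, (e (o i) v * a) ^ 2 = a ^ 2 := by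
    intro i
    have h : inner ℝ (o i : EuclideanSpace ℝ V) (o i : EuclideanSpace ℝ V) = 1 := by
      rw [real_inner_self_eq_norm_sq, ho.1 i, one_pow]
    rw [hin, dotProduct] at h
    simp only [mul_pow, ← sum_mul]
    simp only [sq (e _ _), h, one_mul]
  calc (Module.finrank ℝ K : ℝ) * a ^ 2 = ∑ i, ∑ v, (e (o i) v * a) ^ 2 := by
        simp [h2, hrank]
    _ = ∑ v, ∑ i, (e (o i) v * a) ^ 2 := sum_comm
    _ ≤ ∑ _v : V, b := sum_le_sum fun v _ => h1 v
    _ = _ := by simp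

/-! ### Local spectral bounds and contraction after deletion -/

namespace IsLoopedAdj

open Matrix Finset

theorem dotProduct_mulVec_comm {V : Type*} [Fintype V] {Q : Matrix V V ℝ}
    (hQ : IsLoopedAdj Q) (x y : V → ℝ) : x ⬝ᵥ Q *ᵥ y = Q *ᵥ x ⬝ᵥ y := by
  rw [dotProduct_mulVec, ← mulVec_transpose, hQ.symm.eq]

variable {V : Type*} [Fintype V] [DecidableEq V] {Q : Matrix V V ℝ}

/-- The largest eigenvalue of the graph induced on the ball of radius `R` around `v` is at most
`μ`. -/
def _root_.BallBounded (Q : Matrix V V ℝ) (μ : ℝ) (v : V) (R : ℕ) : Prop :=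
  ∀ w : V → ℝ, (∀ u, 0 ≤ w u) → (∀ u, u ∉ walkBall Q v R → w u = 0) →
    w ⬝ᵥ Q *ᵥ w ≤ μ * (w ⬝ᵥ w)

theorem mulVec_support (hQ : IsLoopedAdj Q) {v : V} {j k : ℕ} {x : V → ℝ}
    (hx : ∀ u, u ∉ walkBall Q v j → x u = 0) {u : V} (hu : u ∉ walkBall Q v (j + k)) :
    (Q ^ k *ᵥ x) u = 0 := by
  refine sum_eq_zero fun w _ => ?_
  by_cases hw : w ∈ walkBall Q v j
  · by_cases huw : (Q ^ k) u w = 0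
    · simp [huw]
    · exact absurd (hQ.ball_trans hw (hQ.ball_comm (mem_ball.2 huw))) hu
  · simp [hx w hw]

/-- Entries of `Q` are nonnegative, so passing from `w` to `|w|` can only increase the absolute
value of the form. This also controls negative eigenvalues. -/
theorem abs_form_le (hQ : IsLoopedAdj Q) {μ : ℝ} {v : V} {R : ℕ} (hg : BallBounded Q μ v R)
    {w : V → ℝ} (hw : ∀ u, u ∉ walkBall Q v R → w u = 0) :
    |w ⬝ᵥ Q *ᵥ w| ≤ μ * (w ⬝ᵥ w) := by
  have h := hg (fun u => |w u|) (fun u => abs_nonneg _) (fun u hu => by simp [hw u hu])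
  have h2 : (fun u => |w u|) ⬝ᵥ (fun u => |w u|) = w ⬝ᵥ w := by
    simp [dotProduct]
  rw [h2] at h
  refine le_trans ?_ h
  simp only [dotProduct, mulVec, mul_sum]
  refine (abs_sum_le_sum_abs _ _).trans (sum_le_sum fun u _ => ?_)
  refine (abs_sum_le_sum_abs _ _).trans (sum_le_sum fun u' _ => ?_)
  rw [abs_mul, abs_mul, abs_of_nonneg (hQ.nonneg _ _)]

/-- Polarization: with `z = Q x`, the upper bound at `μ x + z` minus the lower bound at `μ x - z`
gives `4 μ |z|² ≤ 2 μ (μ² |x|² + |z|²)`. One spare unit of radius keeps `z` inside the ball. -/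
theorem mulVec_sq_le (hQ : IsLoopedAdj Q) {μ : ℝ} (hμ : 0 < μ) {v : V} {R : ℕ}
    (hg : BallBounded Q μ v R) {j : ℕ} (hj : j + 1 ≤ R) {x : V → ℝ}
    (hx : ∀ u, u ∉ walkBall Q v j → x u = 0) :
    Q *ᵥ x ⬝ᵥ Q *ᵥ x ≤ μ ^ 2 * (x ⬝ᵥ x) := by
  have hx0 : ∀ u, u ∉ walkBall Q v R → x u = 0 := fun u hu =>
    hx u fun h => hu (hQ.ball_mono v (by omega) h)
  have hz0 : ∀ u, u ∉ walkBall Q v R → (Q *ᵥ x) u = 0 := fun u hu => by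
    have := hQ.mulVec_support hx (k := 1) (u := u) fun h => hu (hQ.ball_mono v hj h)
    rwa [pow_one] at this
  set z := Q *ᵥ x with hz
  have h1 := (abs_le.1 (hQ.abs_form_le hg (w := μ • x + z)
    (fun u hu => by simp [hx0 u hu, hz0 u hu]))).2
  have h2 := (abs_le.1 (hQ.abs_form_le hg (w := μ • x - z)
    (fun u hu => by simp [hx0 u hu, hz0 u hu]))).1
  have hc : z ⬝ᵥ Q *ᵥ x = z ⬝ᵥ z := rfl
  have hc' : x ⬝ᵥ Q *ᵥ z = z ⬝ᵥ z := by rw [hQ.dotProduct_mulVec_comm]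
  have hd : z ⬝ᵥ x = x ⬝ᵥ z := dotProduct_comm _ _
  simp only [mulVec_add, mulVec_sub, mulVec_smul, dotProduct_add, add_dotProduct, smul_dotProduct,
    dotProduct_smul, dotProduct_sub, sub_dotProduct, smul_eq_mul, hc, hc', hd] at h1 h2
  have h3 : μ * (z ⬝ᵥ z) ≤ μ * (μ ^ 2 * (x ⬝ᵥ x)) := by nlinarith
  exact le_of_mul_le_mul_left h3 hμ

theorem pow_mulVec_sq_le (hQ : IsLoopedAdj Q) {μ : ℝ} (hμ : 0 < μ) {v : V} {R : ℕ}
    (hg : BallBounded Q μ v R) {j k : ℕ} (hj : j + k ≤ R) {x : V → ℝ}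
    (hx : ∀ u, u ∉ walkBall Q v j → x u = 0) :
    Q ^ k *ᵥ x ⬝ᵥ Q ^ k *ᵥ x ≤ (μ ^ 2) ^ k * (x ⬝ᵥ x) := by
  induction k with
  | zero => simp
  | succ k ih =>
    rw [pow_succ', ← mulVec_mulVec]
    refine (hQ.mulVec_sq_le hμ hg (j := j + k) (by omega)
      fun u hu => hQ.mulVec_support hx hu).trans ?_
    rw [pow_succ' (μ ^ 2), mul_assoc]
    exact mul_le_mul_of_nonneg_left (ih (by omega)) (by positivity)

/-- The matrix `Q` with the rows and columns indexed by `X` replaced by zero. -/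
def _root_.deleteVerts (Q : Matrix V V ℝ) (X : Finset V) : Matrix V V ℝ :=
  fun i j => if i ∈ X ∨ j ∈ X then 0 else Q i j

theorem deleteVerts_pow (hQ : IsLoopedAdj Q) (X : Finset V) (k : ℕ) (i j : V) :
    0 ≤ (deleteVerts Q X ^ k) i j ∧ (deleteVerts Q X ^ k) i j ≤ (Q ^ k) i j := by
  induction k generalizing i j with
  | zero => by_cases h : i = j <;> simp [h]
  | succ k ih =>
    have h1 : ∀ l j, 0 ≤ deleteVerts Q X l j ∧ deleteVerts Q X l j ≤ Q l j := by
      intro l j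
      have := hQ.nonneg l j
      unfold deleteVerts
      split_ifs <;> simp [this]
    simp only [pow_succ, Matrix.mul_apply]
    exact ⟨sum_nonneg fun l _ => mul_nonneg (ih i l).1 (h1 l j).1,
      sum_le_sum fun l _ => mul_le_mul (ih i l).2 (h1 l j).2 (h1 l j).1 (hQ.pow_nonneg k i l)⟩

theorem _root_.deleteVerts_mulVec_eq_zero {X : Finset V} {k : ℕ} (hk : k ≠ 0)
    (x : V → ℝ) {i : V} (hi : i ∈ X) : (deleteVerts Q X ^ k *ᵥ x) i = 0 := by
  obtain ⟨k, rfl⟩ := Nat.exists_eq_succ_of_ne_zero hk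
  rw [Nat.succ_eq_add_one, pow_succ', ← mulVec_mulVec]
  exact sum_eq_zero fun l _ => by simp [deleteVerts, hi]

/-- Deleting a dominating set at distance `r` makes the `r`-th power contract. -/
theorem deleteVerts_sq_le (hQ : IsLoopedAdj Q) {μ : ℝ} (hμ : 0 < μ) {v : V} {R : ℕ}
    (hg : BallBounded Q μ v R) {j r : ℕ} (hr : r ≠ 0) (hj : j + r ≤ R) {X U : Finset V}
    (hUX : U ⊆ X) (hU : ∀ u, u ∉ X → ∃ w ∈ U, u ∈ walkBall Q w r) {x : V → ℝ}
    (hx0 : ∀ u, 0 ≤ x u) (hxX : ∀ u ∈ X, x u = 0)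
    (hx : ∀ u, u ∉ walkBall Q v j → x u = 0) :
    deleteVerts Q X ^ r *ᵥ x ⬝ᵥ deleteVerts Q X ^ r *ᵥ x ≤ ((μ ^ 2) ^ r - 1) * (x ⬝ᵥ x) := by
  have hmain := hQ.pow_mulVec_sq_le hμ hg hj hx
  suffices h : deleteVerts Q X ^ r *ᵥ x ⬝ᵥ deleteVerts Q X ^ r *ᵥ x + x ⬝ᵥ x ≤
      Q ^ r *ᵥ x ⬝ᵥ Q ^ r *ᵥ x by linarith
  set y := Q ^ r *ᵥ x with hy
  set y' := deleteVerts Q X ^ r *ᵥ x with hy'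
  have hyy : ∀ u, 0 ≤ y' u ∧ y' u ≤ y u := fun u =>
    ⟨sum_nonneg fun w _ => mul_nonneg (hQ.deleteVerts_pow X r u w).1 (hx0 w),
      sum_le_sum fun w _ => mul_le_mul_of_nonneg_right (hQ.deleteVerts_pow X r u w).2 (hx0 w)⟩
  have h1 : y' ⬝ᵥ y' ≤ ∑ u ∈ univ \ U, y u * y u := by
    have : y' ⬝ᵥ y' = ∑ u ∈ univ \ U, y' u * y' u := by
      refine (sum_subset (subset_univ _) fun u _ hu => ?_).symm
      have : u ∈ U := by simpa using hu
      simp [hy', deleteVerts_mulVec_eq_zero hr x (hUX this)]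
    rw [this]
    exact sum_le_sum fun u _ => mul_self_le_mul_self (hyy u).1 (hyy u).2
  -- The deleted coordinates in `U` carry squared norm at least `|x|²`: `y w` dominates the sum of
  -- `x` over the ball of `w`, and these balls cover the support of `x`.
  have h2 : ∀ w, ∑ u ∈ walkBall Q w r, x u * x u ≤ y w * y w := by
    intro w
    have h3 : ∑ u ∈ walkBall Q w r, x u ≤ y w := by
      calc ∑ u ∈ walkBall Q w r, x u ≤ ∑ u ∈ walkBall Q w r, (Q ^ r) w u * x u :=
            sum_le_sum fun u hu => le_mul_of_one_le_left (hx0 u) (hQ.one_le_of_mem hu)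
        _ ≤ _ := sum_le_sum_of_subset_of_nonneg (subset_univ _) fun u _ _ =>
            mul_nonneg (hQ.pow_nonneg r w u) (hx0 u)
    have h4 := sum_sq_le_sq_sum_of_nonneg (s := walkBall Q w r) (f := x) fun u _ => hx0 u
    have h5 := mul_self_le_mul_self (sum_nonneg fun u _ => hx0 u) h3
    simp only [sq] at h4
    exact h4.trans h5
  have h3 : x ⬝ᵥ x ≤ ∑ u ∈ U, y u * y u := by
    calc x ⬝ᵥ x ≤ ∑ u, ∑ w ∈ U, if u ∈ walkBall Q w r then x u * x u else 0 := by
          have hnn : ∀ u, ∀ w ∈ U, 0 ≤ if u ∈ walkBall Q w r then x u * x u else 0 := by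
            intro u w _
            split_ifs
            exacts [mul_self_nonneg _, le_rfl]
          refine sum_le_sum fun u _ => ?_
          by_cases huX : u ∈ X
          · simp [hxX u huX]
          · obtain ⟨w, hw, huw⟩ := hU u huX
            simpa [huw] using single_le_sum (hnn u) hw
      _ = ∑ w ∈ U, ∑ u ∈ walkBall Q w r, x u * x u := by
          rw [sum_comm]
          exact sum_congr rfl fun w _ => by rw [sum_ite_mem, univ_inter]
      _ ≤ _ := sum_le_sum fun w _ => h2 w
  have h4 : y ⬝ᵥ y = ∑ u ∈ univ \ U, y u * y u + ∑ u ∈ U, y u * y u :=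
    (sum_sdiff (subset_univ U)).symm
  linarith

/-- Starting from a point mass at `v`, the support spreads by at most `r` per block, so all `t`
blocks stay where the local bound applies. -/
theorem deleteVerts_iterate (hQ : IsLoopedAdj Q) {μ : ℝ} (hμ : 1 ≤ μ) {v : V} {R : ℕ}
    (hg : BallBounded Q μ v R) {r t : ℕ} (hr : r ≠ 0) (ht : r * t ≤ R) {X U : Finset V}
    (hUX : U ⊆ X) (hU : ∀ u, u ∉ X → ∃ w ∈ U, u ∈ walkBall Q w r) (hv : v ∉ X) :
    deleteVerts Q X ^ (r * t) *ᵥ Pi.single v 1 ⬝ᵥ deleteVerts Q X ^ (r * t) *ᵥ Pi.single v 1 ≤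
      ((μ ^ 2) ^ r - 1) ^ t := by
  induction t with
  | zero => rw [Nat.mul_zero, pow_zero, one_mulVec]; simp
  | succ t ih =>
    have hle := (ih (by rw [Nat.mul_succ] at ht; omega))
    rw [Nat.mul_succ, add_comm, pow_add, ← mulVec_mulVec]
    refine (hQ.deleteVerts_sq_le (by linarith) hg (j := r * t) hr ht hUX hU ?_ ?_ ?_).trans ?_
    · intro u
      simpa using (hQ.deleteVerts_pow X (r * t) u v).1
    · intro u hu
      rcases Nat.eq_zero_or_pos t with rfl | htp
      · have : u ≠ v := fun h => hv (h ▸ hu)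
        simp [this]
      · exact deleteVerts_mulVec_eq_zero (Nat.mul_ne_zero hr htp.ne') _ hu
    · intro u hu
      have h1 := hQ.deleteVerts_pow X (r * t) u v
      have h2 : (Q ^ (r * t)) u v = 0 := by
        by_contra h
        exact hu (hQ.ball_comm (mem_ball.2 h))
      rw [h2] at h1
      simpa using le_antisymm h1.2 h1.1
    · rw [pow_succ' (_ - _)]
      refine mul_le_mul_of_nonneg_left hle ?_
      have : 1 ≤ (μ ^ 2) ^ r := one_le_pow₀ (one_le_pow₀ hμ)
      linarith

end IsLoopedAdj

/-! ### Multiplicity of the eigenvalue `μ` -/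

/-- Restricting a subspace to the kernel of a linear map lowers the dimension by at most the
dimension of the target. -/
theorem Submodule.finrank_le_finrank_add_inf_ker {E F : Type*} [AddCommGroup E] [Module ℝ E]
    [FiniteDimensional ℝ E] [AddCommGroup F] [Module ℝ F] [FiniteDimensional ℝ F]
    (K : Submodule ℝ E) (L : E →ₗ[ℝ] F) :
    Module.finrank ℝ K ≤
      Module.finrank ℝ F + Module.finrank ℝ (K ⊓ LinearMap.ker L : Submodule ℝ E) := by
  have h1 := (L.domRestrict K).finrank_range_add_finrank_ker
  have h2 := Submodule.finrank_le (LinearMap.range (L.domRestrict K))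
  have h3 : Module.finrank ℝ (LinearMap.ker (L.domRestrict K)) =
      Module.finrank ℝ (K ⊓ LinearMap.ker L : Submodule ℝ E) := by
    have : LinearMap.ker (L.domRestrict K) = (K ⊓ LinearMap.ker L).comap K.subtype := by
      ext x
      simp
    rw [this]
    exact (Submodule.comapSubtypeEquivOfLe inf_le_left).finrank_eq
  omega

namespace IsLoopedAdj

open Matrix Finset

variable {V : Type*} [Fintype V] [DecidableEq V] {Q : Matrix V V ℝ}

/-- If the quadratic form is at most `μ` on the orthogonal complement of the constants, then the
balls of radius `R` violating the bound are all close to each other. -/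
theorem mem_ball_of_not_bounded (hQ : IsLoopedAdj Q) {μ : ℝ}
    (hform : ∀ f : V → ℝ, ∑ i, f i = 0 → f ⬝ᵥ Q *ᵥ f ≤ μ * (f ⬝ᵥ f)) {R : ℕ} {v v' : V}
    (hv : ¬ BallBounded Q μ v R) (hv' : ¬ BallBounded Q μ v' R) :
    v' ∈ walkBall Q v (R + 1 + R) := by
  by_contra hfar
  unfold BallBounded at hv hv'
  push Not at hv hv'
  obtain ⟨w, hw0, hws, hw⟩ := hv
  obtain ⟨w', hw0', hws', hw'⟩ := hv'
  have hpos : ∀ w : V → ℝ, (∀ u, 0 ≤ w u) → μ * (w ⬝ᵥ w) < w ⬝ᵥ Q *ᵥ w → 0 < ∑ u, w u := by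
    intro w hw0 hw
    refine lt_of_le_of_ne (sum_nonneg fun u _ => hw0 u) fun h => ?_
    have : w = 0 := by
      ext u
      exact (sum_eq_zero_iff_of_nonneg fun u _ => hw0 u).1 h.symm u (mem_univ u)
    simp [this] at hw
  have hs := hpos w hw0 hw
  have hs' := hpos w' hw0' hw'
  have hsep : ∀ u u', w u ≠ 0 → w' u' ≠ 0 → Q u u' = 0 := by
    intro u u' hu hu'
    by_contra h
    have h1 : u ∈ walkBall Q v R := by by_contra h; exact hu (hws u h)
    have h2 : u' ∈ walkBall Q v' R := by by_contra h; exact hu' (hws' u' h)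
    exact hfar (hQ.ball_trans (hQ.ball_trans h1 (mem_ball_one.2 h)) (hQ.ball_comm h2))
  have hx1 : w ⬝ᵥ w' = 0 := by
    refine sum_eq_zero fun u _ => ?_
    by_contra h
    have := hsep u u (left_ne_zero_of_mul h) (right_ne_zero_of_mul h)
    simp [hQ.diag] at this
  have hx2 : w ⬝ᵥ Q *ᵥ w' = 0 := by
    refine sum_eq_zero fun u _ => ?_
    by_cases hu : w u = 0
    · simp [hu]
    · refine mul_eq_zero_of_right _ (sum_eq_zero fun u' _ => ?_)
      by_cases hu' : w' u' = 0
      · simp [hu']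
      · simp [hsep u u' hu hu']
  have hx3 : w' ⬝ᵥ Q *ᵥ w = 0 := by rw [hQ.dotProduct_mulVec_comm, dotProduct_comm, hx2]
  have hx4 : w' ⬝ᵥ w = 0 := by rw [dotProduct_comm, hx1]
  -- This combination has coordinate sum zero, and all cross terms vanish because the two supports
  -- are neither overlapping nor adjacent.
  have := hform ((∑ u, w' u) • w - (∑ u, w u) • w') (by
    simp only [Pi.sub_apply, Pi.smul_apply, smul_eq_mul, sum_sub_distrib, ← mul_sum]
    ring)
  simp only [mulVec_sub, mulVec_smul, smul_dotProduct,
    dotProduct_smul, dotProduct_sub, sub_dotProduct, smul_eq_mul, hx1, hx2, hx3, hx4] at this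
  have h1 := mul_lt_mul_of_pos_left hw (mul_pos hs' hs')
  have h2 := mul_lt_mul_of_pos_left hw' (mul_pos hs hs)
  linarith

/-- A maximal family of disjoint balls of radius `m`: disjointness bounds its size, maximality makes
its centres a net at twice the radius. -/
theorem exists_net (hQ : IsLoopedAdj Q) (T : Finset V) (m : ℕ)
    (hT : ∀ v ∈ T, m + 1 ≤ (walkBall Q v m).card) :
    ∃ U ⊆ T, U.card * (m + 1) ≤ Fintype.card V ∧
      ∀ v ∈ T, ∃ u ∈ U, v ∈ walkBall Q u (m + m) := by
  classical
  let S := T.powerset.filter fun U : Finset V =>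
    (U : Set V).PairwiseDisjoint fun u => walkBall Q u m
  obtain ⟨U, hU, hmax⟩ := exists_max_image S card ⟨∅, by simp [S]⟩
  simp only [S, mem_filter, mem_powerset] at hU hmax
  refine ⟨U, hU.1, ?_, fun v hv => ?_⟩
  · calc U.card * (m + 1) ≤ ∑ u ∈ U, (walkBall Q u m).card := by
          rw [← smul_eq_mul]
          exact card_nsmul_le_sum _ _ _ fun u hu => hT u (hU.1 hu)
      _ = (U.biUnion fun u => walkBall Q u m).card := (card_biUnion hU.2).symm
      _ ≤ _ := card_le_univ _
  · by_contra! hfar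
    have hvU : v ∉ U := fun h => hfar v h (hQ.self_mem_ball v _)
    have := hmax (insert v U) ⟨insert_subset hv hU.1, by
      rw [coe_insert]
      refine hU.2.insert fun u hu _ => disjoint_left.2 fun w hw hw' => ?_
      exact hfar u hu (hQ.ball_trans hw' (hQ.ball_comm hw))⟩
    rw [card_insert_of_notMem hvU] at this
    omega

/-- The bound for the eigenspace of `μ`, with the parameters `m` and `t` still free. -/
theorem finrank_le_aux (hQ : IsLoopedAdj Q) {μ : ℝ} {D m : ℕ} (hm : (m : ℝ) < μ) (hm0 : m ≠ 0)
    (hμm : μ ≤ m + 1) (hD : ∀ i, ∑ j, Q i j ≤ D)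
    (hform : ∀ f : V → ℝ, ∑ i, f i = 0 → f ⬝ᵥ Q *ᵥ f ≤ μ * (f ⬝ᵥ f))
    (K : Submodule ℝ (V → ℝ)) (hK : ∀ f ∈ K, Q *ᵥ f = μ • f) (t : ℕ) :
    (Module.finrank ℝ K : ℝ) ≤ Fintype.card V / μ +
      (1 - 1 / (μ ^ 2) ^ (m + m)) ^ t * Fintype.card V +
      (D : ℝ) ^ ((m + m) * t + 1 + (m + m) * t) := by
  classical
  have hμ1 : 1 < μ := lt_of_le_of_lt (by exact_mod_cast Nat.one_le_iff_ne_zero.2 hm0) hm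
  set r := m + m with hr
  set R := r * t with hR
  let T : Finset V := univ.filter fun v => m + 1 ≤ (walkBall Q v m).card
  obtain ⟨U, hUT, hUcard, hUnet⟩ := hQ.exists_net T m (by simp [T])
  let B : Finset V := univ.filter fun v => ¬ BallBounded Q μ v R
  have hBcard : B.card ≤ D ^ (R + 1 + R) := by
    rcases B.eq_empty_or_nonempty with h | ⟨v, hv⟩
    · simp [h]
    · refine (card_le_card fun v' hv' => ?_).trans (hQ.card_ball_le hD v (R + 1 + R))
      simp only [B, mem_filter, mem_univ, true_and] at hv hv'
      exact hQ.mem_ball_of_not_bounded hform hv hv'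
  let W := U ∪ B
  let X := W ∪ Tᶜ
  let L : (V → ℝ) →ₗ[ℝ] (W → ℝ) := LinearMap.funLeft ℝ ℝ Subtype.val
  have h1 := K.finrank_le_finrank_add_inf_ker L
  set K' := K ⊓ LinearMap.ker L with hK'
  have hX : ∀ f ∈ K', ∀ v ∈ X, f v = 0 := by
    intro f hf v hv
    rcases mem_union.1 hv with h | h
    · exact congrFun (LinearMap.mem_ker.1 hf.2) ⟨v, h⟩
    · have h2 : ¬ m + 1 ≤ (walkBall Q v m).card := by simpa [T] using h
      refine hQ.eigenvector_eq_zero (hK f hf.1) (C := walkBall Q v m) ?_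
        ((hQ.ball_large_or_closed v m).resolve_left h2) (hQ.self_mem_ball v m)
      exact lt_of_le_of_lt (by exact_mod_cast (by omega)) hm
  -- Since `f` vanishes on `X`, deleting `X` leaves the eigenvalue equation intact.
  have hQ' : ∀ f ∈ K', ∀ k : ℕ, deleteVerts Q X ^ k *ᵥ f = μ ^ k • f := by
    intro f hf k
    induction k with
    | zero => simp
    | succ k ih =>
      have : deleteVerts Q X *ᵥ f = μ • f := by
        ext v
        by_cases hv : v ∈ X
        · have := deleteVerts_mulVec_eq_zero (Q := Q) one_ne_zero f hv
          rw [pow_one] at this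
          simp [this, hX f hf v hv]
        · rw [← hK f hf.1]
          refine sum_congr rfl fun u _ => ?_
          by_cases hu : u ∈ X
          · simp [hX f hf u hu]
          · simp [deleteVerts, hu, hv]
      rw [pow_succ, ← mulVec_mulVec, this, mulVec_smul, ih, smul_smul, pow_succ']
  have hsymm : (deleteVerts Q X).IsSymm := by
    ext i j
    simp [deleteVerts, or_comm, hQ.symm.apply i j]
  have hμr : 1 ≤ (μ ^ 2) ^ r := one_le_pow₀ (one_le_pow₀ hμ1.le)
  -- By symmetry `μ ^ R * f v` is the inner product of `f` with the deleted walk from `v`. For `v ∈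
  -- X` the zero vector serves, as `f v = 0`.
  have hb := finrank_mul_sq_le K' (μ ^ R) (((μ ^ 2) ^ r - 1) ^ t)
    (fun v => if v ∈ X then 0 else deleteVerts Q X ^ R *ᵥ Pi.single v 1) (by
      intro f hf v
      by_cases hv : v ∈ X
      · simp [hv, hX f hf v hv]
      · simp only [hv, if_false]
        rw [dotProduct_mulVec, ← mulVec_transpose, (hsymm.pow R).eq, hQ' f hf]
        simp [mul_comm]) (by
      intro v
      by_cases hv : v ∈ X
      · simp only [hv, if_true, dotProduct_zero]
        exact _root_.pow_nonneg (by linarith) t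
      · simp only [hv, if_false]
        have hvB : v ∉ B := fun h => hv (mem_union_left _ (mem_union_right _ h))
        have hvg : BallBounded Q μ v R := by simpa [B] using hvB
        refine hQ.deleteVerts_iterate hμ1.le hvg (by omega) le_rfl (U := U)
          (fun u hu => mem_union_left _ (mem_union_left _ hu)) (fun u hu => ?_) hv
        refine hUnet u ?_
        by_contra h
        exact hu (mem_union_right _ (mem_compl.2 h)))
  have hb' : (Module.finrank ℝ K' : ℝ) ≤
      (1 - 1 / (μ ^ 2) ^ r) ^ t * Fintype.card V := by
    have hp : 0 < ((μ ^ 2) ^ r) ^ t := by positivity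
    have he : (μ ^ R) ^ 2 = ((μ ^ 2) ^ r) ^ t := by
      rw [hR, ← pow_mul, ← pow_mul, ← pow_mul]
      ring
    rw [he] at hb
    have : (1 - 1 / (μ ^ 2) ^ r) ^ t = ((μ ^ 2) ^ r - 1) ^ t / ((μ ^ 2) ^ r) ^ t := by
      rw [← div_pow, sub_div, div_self (by positivity)]
    rw [this, div_mul_eq_mul_div, le_div_iff₀ hp]
    linarith
  have hU' : (U.card : ℝ) ≤ Fintype.card V / μ := by
    rw [le_div_iff₀ (by linarith)]
    calc (U.card : ℝ) * μ ≤ U.card * (m + 1) :=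
          mul_le_mul_of_nonneg_left hμm (Nat.cast_nonneg _)
      _ ≤ _ := by exact_mod_cast hUcard
  have hW : (Module.finrank ℝ (W → ℝ) : ℝ) ≤ U.card + B.card := by
    rw [Module.finrank_fintype_fun_eq_card, Fintype.card_coe]
    exact_mod_cast card_union_le U B
  have hB' : (B.card : ℝ) ≤ (D : ℝ) ^ (R + 1 + R) := by exact_mod_cast hBcard
  have h1' : (Module.finrank ℝ K : ℝ) ≤ Module.finrank ℝ (W → ℝ) + Module.finrank ℝ K' := by
    exact_mod_cast h1
  linarith

end IsLoopedAdj

/-- In a graph of bounded degree whose quadratic form is at most `μ` on the complement of the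
constants, the multiplicity of the eigenvalue `μ` is at most `(1 / μ + o(1)) |V|`. -/
theorem exists_finrank_eigenspace_le {μ : ℝ} (hμ : 1 < μ) (D : ℕ) {ε : ℝ} (hε : 0 < ε) :
    ∃ C : ℝ, ∀ (V : Type) [Fintype V] [DecidableEq V] (Q : Matrix V V ℝ), IsLoopedAdj Q →
      (∀ i, ∑ j, Q i j ≤ D) →
      (∀ f : V → ℝ, ∑ i, f i = 0 → f ⬝ᵥ Q.mulVec f ≤ μ * (f ⬝ᵥ f)) →
      ∀ K : Submodule ℝ (V → ℝ), (∀ f ∈ K, Q.mulVec f = μ • f) →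
        (Module.finrank ℝ K : ℝ) ≤ Fintype.card V / μ + ε * Fintype.card V + C := by
  -- `m = ⌈μ⌉ - 1` serves both needs: `m < μ` annihilates eigenvectors on small components, and `m +
  -- 1 ≥ μ` gives the density `1 / μ` of the net.
  obtain ⟨m, hm⟩ : ∃ m, ⌈μ⌉₊ = m + 1 :=
    Nat.exists_eq_add_one.2 (Nat.ceil_pos.2 (by linarith))
  have hmμ : (m : ℝ) < μ := Nat.lt_ceil.1 (by omega)
  have hμm : μ ≤ m + 1 := by
    have := Nat.le_ceil μ
    rw [hm] at this
    exact_mod_cast this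
  have hm0 : m ≠ 0 := by
    rintro rfl
    norm_num at hμm
    linarith
  have hp : 1 ≤ (μ ^ 2) ^ (m + m) := one_le_pow₀ (one_le_pow₀ hμ.le)
  have hp0 : 0 < 1 / (μ ^ 2) ^ (m + m) := by positivity
  obtain ⟨t, ht⟩ := exists_pow_lt_of_lt_one hε (y := 1 - 1 / (μ ^ 2) ^ (m + m)) (by linarith)
  refine ⟨(D : ℝ) ^ ((m + m) * t + 1 + (m + m) * t), fun V _ _ Q hQ hD hform K hK => ?_⟩
  have := hQ.finrank_le_aux hmμ hm0 hμm hD hform K hK t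
  have h2 := mul_le_mul_of_nonneg_right ht.le (Nat.cast_nonneg (α := ℝ) (Fintype.card V))
  linarith

/-! ### Ramsey's theorem -/

/-- Ramsey's theorem for graphs. -/
theorem exists_ramsey_number (a b : ℕ) : ∃ N : ℕ, ∀ (V : Type) (r : V → V → Prop),
    (∀ x y, r x y → r y x) → ∀ S : Finset V, N ≤ S.card →
      (∃ T ⊆ S, T.card = a ∧ (T : Set V).Pairwise r) ∨
      (∃ T ⊆ S, T.card = b ∧ (T : Set V).Pairwise fun x y => ¬ r x y) := by
  classical
  induction a generalizing b with
  | zero => exact ⟨0, fun V r _ S _ => Or.inl ⟨∅, by simp⟩⟩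
  | succ a iha =>
    induction b with
    | zero => exact ⟨0, fun V r _ S _ => Or.inr ⟨∅, by simp⟩⟩
    | succ b ihb =>
      obtain ⟨N₁, h₁⟩ := iha (b + 1)
      obtain ⟨N₂, h₂⟩ := ihb
      -- Besides `x` there remain at least `N₁ + N₂` points, so `x` has at least `N₁` related or at
      -- least `N₂` unrelated ones.
      refine ⟨N₁ + N₂ + 1, fun V r hr S hS => ?_⟩
      obtain ⟨x, hx⟩ : S.Nonempty := Finset.card_pos.1 (by omega)
      have hcard := Finset.card_filter_add_card_filter_not (s := S.erase x) (fun y => r x y)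
      rw [Finset.card_erase_of_mem hx] at hcard
      have key : ∀ (p q : V → V → Prop), (∀ x y, q x y → q y x) → ∀ T : Finset V,
          (∀ y ∈ T, y ∈ S.erase x ∧ p x y) → (T : Set V).Pairwise q →
          (∀ y, p x y → q x y) → insert x T ⊆ S ∧ (insert x T).card = T.card + 1 ∧
            ((insert x T : Finset V) : Set V).Pairwise q := by
        intro p q hq T hT hpw hpq
        have hxT : x ∉ T := fun h => by simpa using (hT x h).1
        refine ⟨Finset.insert_subset hx fun y hy => ?_, Finset.card_insert_of_notMem hxT, ?_⟩
        · exact Finset.mem_of_mem_erase (hT y hy).1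
        · rw [Finset.coe_insert]
          refine hpw.insert fun y hy _ => ?_
          have := hpq y (hT y hy).2
          exact ⟨this, hq _ _ this⟩
      rcases Nat.lt_or_ge ((S.erase x).filter fun y => r x y).card N₁ with hlt | hge
      · rcases h₂ V r hr ((S.erase x).filter fun y => ¬ r x y) (by omega) with
          ⟨T, hT, hc, hp⟩ | ⟨T, hT, hc, hp⟩
        · exact Or.inl ⟨T, fun y hy => Finset.mem_of_mem_erase (Finset.mem_filter.1 (hT hy)).1,
            hc, hp⟩
        · obtain ⟨k1, k2, k3⟩ := key (fun x y => ¬ r x y) (fun x y => ¬ r x y)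
            (fun x y h h' => h (hr _ _ h')) T
            (fun y hy => Finset.mem_filter.1 (hT hy)) hp fun _ h => h
          exact Or.inr ⟨_, k1, by omega, k3⟩
      · rcases h₁ V r hr _ hge with ⟨T, hT, hc, hp⟩ | ⟨T, hT, hc, hp⟩
        · obtain ⟨k1, k2, k3⟩ := key r r hr T (fun y hy => Finset.mem_filter.1 (hT hy)) hp fun _ h => h
          exact Or.inl ⟨_, k1, by omega, k3⟩
        · exact Or.inr ⟨T, fun y hy => Finset.mem_of_mem_erase (Finset.mem_filter.1 (hT hy)).1,
            hc, hp⟩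

/-! ### Switching to bounded negative degree -/

section Switching

open Finset

variable {E : Type*} [NormedAddCommGroup E] [InnerProductSpace ℝ E] {ι : Type*}

/-- Unit vectors spanning distinct lines with common angle `arccos α`. -/
structure IsEquiangularFamily (α : ℝ) (v : ι → E) : Prop where
  self_inner : ∀ i, inner ℝ (v i) (v i) = 1
  pair_inner : ∀ i j, i ≠ j → inner ℝ (v i) (v j) = α ∨ inner ℝ (v i) (v j) = -α

theorem inner_sum_sum_le {v : ι → E} (hv : ∀ i, inner ℝ (v i) (v i) = 1) {c : ℝ} {T : Finset ι}
    (hT : (T : Set ι).Pairwise fun i j => inner ℝ (v i) (v j) ≤ c) :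
    inner ℝ (∑ i ∈ T, v i) (∑ i ∈ T, v i) ≤ T.card * (1 + (T.card - 1) * c) := by
  classical
  rw [sum_inner]
  simp only [inner_sum]
  rw [← nsmul_eq_mul]
  refine sum_le_card_nsmul _ _ _ fun i hi => ?_
  rw [← add_sum_erase T _ hi, hv]
  have h := sum_le_card_nsmul (T.erase i) (fun j => inner ℝ (v i) (v j)) c fun j hj =>
    hT hi (mem_of_mem_erase hj) (ne_of_mem_erase hj).symm
  rw [nsmul_eq_mul, card_erase_of_mem hi, Nat.cast_pred (card_pos.2 ⟨i, hi⟩)] at h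
  linarith

namespace IsEquiangularFamily

variable {α : ℝ} {v : ι → E}

theorem card_le_of_pairwise_neg (hv : IsEquiangularFamily α v) (hα : 0 < α) {T : Finset ι}
    (hT : (T : Set ι).Pairwise fun i j => inner ℝ (v i) (v j) = -α) :
    T.card ≤ 1 + 1 / α := by
  have h := inner_sum_sum_le hv.self_inner (c := -α) fun i hi j hj hij => (hT hi hj hij).le
  have h0 := real_inner_self_nonneg (x := ∑ i ∈ T, v i)
  rcases T.eq_empty_or_nonempty with rfl | hne
  · simp; positivity
  · have hpos : (0 : ℝ) < T.card := by exact_mod_cast card_pos.2 hne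
    have h1 : 0 ≤ 1 + ((T.card : ℝ) - 1) * -α := by
      by_contra! h2
      nlinarith
    have : (T.card : ℝ) - 1 ≤ 1 / α := by rw [le_div_iff₀ hα]; linarith
    linarith

/-- A large equiangular family contains a large subfamily with all inner products positive. -/
theorem exists_positive_subfamily_size {α : ℝ} (hα : 0 < α) (M : ℕ) : ∃ N : ℕ,
    ∀ (E : Type) [NormedAddCommGroup E] [InnerProductSpace ℝ E] (ι : Type) [Fintype ι] (v : ι → E), IsEquiangularFamily α v → N ≤ Fintype.card ι →
      ∃ P : Finset ι, P.card = M ∧ (P : Set ι).Pairwise fun i j => inner ℝ (v i) (v j) = α := by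
  obtain ⟨q, hq⟩ := exists_nat_gt (1 + 1 / α)
  obtain ⟨N, hN⟩ := exists_ramsey_number M q
  refine ⟨N, fun E _ _ ι _ v hv hc => ?_⟩
  rcases hN ι (fun i j => inner ℝ (v i) (v j) = α) (fun i j h => by rwa [real_inner_comm])
    univ hc with ⟨T, -, hT, hp⟩ | ⟨T, -, hT, hp⟩
  · exact ⟨T, hT, hp⟩
  · have := hv.card_le_of_pairwise_neg hα (T := T) fun i hi j hj hij =>
      (hv.pair_inner i j hij).resolve_left (hp hi hj hij)
    rw [hT] at this
    linarith

/-- Cauchy–Schwarz for `x` and the difference of the sums over `A` and `B`: the inner product is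
`-2kα`, while the squared norm is at most `2k(1 - α)`, its quadratic terms in `k` cancelling. -/
theorem minority_le (hv : IsEquiangularFamily α v) {P A B : Finset ι}
    (hP : (P : Set ι).Pairwise fun i j => inner ℝ (v i) (v j) = α) (hA : A ⊆ P) (hB : B ⊆ P)
    (hAB : Disjoint A B) {k : ℕ} (hAk : A.card = k) (hBk : B.card = k) {x : E}
    (hx : inner ℝ x x = 1) (hxA : ∀ p ∈ A, inner ℝ x (v p) = -α)
    (hxB : ∀ p ∈ B, inner ℝ x (v p) = α) : 2 * α ^ 2 * k ≤ 1 - α ∨ k = 0 := by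
  have h1 := inner_sum_sum_le hv.self_inner (c := α) (T := A)
    fun i hi j hj hij => (hP (hA hi) (hA hj) hij).le
  have h2 := inner_sum_sum_le hv.self_inner (c := α) (T := B)
    fun i hi j hj hij => (hP (hB hi) (hB hj) hij).le
  have h3 : inner ℝ (∑ i ∈ A, v i) (∑ i ∈ B, v i) = k * (k * α) := by
    rw [sum_inner]
    simp only [inner_sum]
    have : ∀ i ∈ A, ∑ j ∈ B, inner ℝ (v i) (v j) = k * α := by
      intro i hi
      rw [← hBk, ← nsmul_eq_mul]
      refine sum_eq_card_nsmul fun j hj => hP (hA hi) (hB hj) ?_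
      rintro rfl
      exact disjoint_left.1 hAB hi hj
    rw [sum_eq_card_nsmul this, hAk, nsmul_eq_mul]
  have h4 : inner ℝ x (∑ i ∈ A, v i) = k * -α := by
    rw [inner_sum, sum_eq_card_nsmul hxA, hAk, nsmul_eq_mul]
  have h5 : inner ℝ x (∑ i ∈ B, v i) = k * α := by
    rw [inner_sum, sum_eq_card_nsmul hxB, hBk, nsmul_eq_mul]
  have h6 := real_inner_mul_inner_self_le x (∑ i ∈ A, v i - ∑ i ∈ B, v i)
  have h7 := real_inner_comm (∑ i ∈ A, v i) (∑ i ∈ B, v i)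
  simp only [inner_sub_left, inner_sub_right, h4, h5, h3, hx, h7] at h6
  rw [hAk] at h1
  rw [hBk] at h2
  rcases Nat.eq_zero_or_pos k with h | h
  · exact Or.inr h
  · left
    have hk : (0 : ℝ) < k := by exact_mod_cast h
    have h8 : (2 * k : ℝ) * (2 * α ^ 2 * k) ≤ (2 * k) * (1 - α) := by nlinarith
    exact le_of_mul_le_mul_left h8 (by linarith)

/-- Up to sign, each vector of the family has large inner product with the sum of a positive
subfamily. -/
theorem exists_sign (hv : IsEquiangularFamily α v) (hα : 0 < α) (hα1 : α < 1) {P : Finset ι}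
    (hP : (P : Set ι).Pairwise fun i j => inner ℝ (v i) (v j) = α) {k : ℕ} (hk0 : k ≠ 0)
    (hk : 1 - α < 2 * α ^ 2 * k) (i : ι) :
    ∃ w : E, (w = v i ∨ w = -v i) ∧ α * (P.card - 2 * k) ≤ inner ℝ w (∑ p ∈ P, v p) := by
  classical
  have hkn : (0 : ℝ) ≤ k := Nat.cast_nonneg k
  by_cases hi : i ∈ P
  · refine ⟨v i, Or.inl rfl, ?_⟩
    have : ∀ p ∈ P, α ≤ inner ℝ (v i) (v p) := by
      intro p hp
      by_cases hip : i = p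
      · rw [← hip, hv.self_inner]; exact hα1.le
      · exact (hP hi hp hip).ge
    have := card_nsmul_le_sum P _ _ this
    rw [inner_sum]
    rw [nsmul_eq_mul] at this
    nlinarith
  · let A := P.filter fun p => inner ℝ (v i) (v p) = -α
    let B := P.filter fun p => ¬ inner ℝ (v i) (v p) = -α
    have hA : ∀ p ∈ A, inner ℝ (v i) (v p) = -α := fun p hp => (mem_filter.1 hp).2
    have hB : ∀ p ∈ B, inner ℝ (v i) (v p) = α := fun p hp =>
      (hv.pair_inner i p fun h => hi (h ▸ (mem_filter.1 hp).1)).resolve_right (mem_filter.1 hp).2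
    have hAB : A.card + B.card = P.card :=
      card_filter_add_card_filter_not (s := P) fun p => inner ℝ (v i) (v p) = -α
    have hABr : (A.card : ℝ) + B.card = P.card := by exact_mod_cast hAB
    have hsum : inner ℝ (v i) (∑ p ∈ P, v p) = A.card * -α + B.card * α := by
      rw [inner_sum, ← sum_filter_add_sum_filter_not P fun p => inner ℝ (v i) (v p) = -α,
        sum_eq_card_nsmul hA, sum_eq_card_nsmul hB, nsmul_eq_mul, nsmul_eq_mul]
    have hor : A.card < k ∨ B.card < k := by
      by_contra! h
      obtain ⟨A', hA', hA'k⟩ := exists_subset_card_eq h.1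
      obtain ⟨B', hB', hB'k⟩ := exists_subset_card_eq h.2
      rcases hv.minority_le hP (hA'.trans (filter_subset _ _)) (hB'.trans (filter_subset _ _))
        (disjoint_of_subset_left hA' (disjoint_of_subset_right hB'
          (disjoint_filter_filter_not P P _))) hA'k hB'k
        (hv.self_inner i) (fun p hp => hA p (hA' hp)) (fun p hp => hB p (hB' hp)) with h | h
      · linarith
      · exact hk0 h
    rcases hor with h | h
    · refine ⟨v i, Or.inl rfl, ?_⟩
      have : (A.card : ℝ) ≤ k := by exact_mod_cast h.le
      rw [hsum, ← hABr]
      nlinarith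
    · refine ⟨-v i, Or.inr rfl, ?_⟩
      have : (B.card : ℝ) ≤ k := by exact_mod_cast h.le
      rw [inner_neg_left, hsum, ← hABr]
      nlinarith

theorem of_sign (hv : IsEquiangularFamily α v) {w : ι → E}
    (hw : ∀ i, w i = v i ∨ w i = -v i) : IsEquiangularFamily α w where
  self_inner i := by
    have := hv.self_inner i
    rcases hw i with h | h <;> rw [h] <;> simpa only [inner_neg_neg]
  pair_inner i j hij := by
    rcases hw i with h | h <;> rcases hw j with h' | h' <;>
      rcases hv.pair_inner i j hij with h'' | h'' <;> simp [h, h', h'']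

/-- With `z` the sum of `K` negative neighbours of `v i`, subtract from `v i + t z` nearly its
projection onto `s`. If there were `K` such neighbours, the squared norm of `M (v i + t z) - (1 + t
K) s` would have `M²` coefficient at most `(1 - α) - 4αtK + t²K(1 - α)` plus an error linear in `M`;
`hlarge` makes the total negative. -/
theorem negative_card_lt (hv : IsEquiangularFamily α v) (hα : 0 < α) {M k K : ℕ}
    (hM : 0 < M) {s : E} (hs : inner ℝ s s ≤ M * (1 + (M - 1) * α))
    (hvs : ∀ i, α * (M - 2 * k) ≤ inner ℝ (v i) s) {t : ℝ} (ht : 0 ≤ t)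
    (hlarge : (1 + t * K) ^ 2 * (4 * k * α + 1) <
      M * (4 * α * t * K - t ^ 2 * K * (1 - α) - (1 - α)))
    (i : ι) {T : Finset ι} (hT : ∀ j ∈ T, inner ℝ (v i) (v j) = -α) : T.card < K := by
  by_contra! hge
  obtain ⟨T', hT', hK⟩ := exists_subset_card_eq hge
  have h1 : inner ℝ (v i) (∑ j ∈ T', v j) = K * -α := by
    rw [inner_sum, sum_eq_card_nsmul fun j hj => hT j (hT' hj), hK, nsmul_eq_mul]
  have h2 := inner_sum_sum_le hv.self_inner (c := α) (T := T') fun j _ l _ hjl => by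
    rcases hv.pair_inner j l hjl with h | h <;> rw [h]
    linarith
  rw [hK] at h2
  have h3 : K * (α * (M - 2 * k)) ≤ inner ℝ (∑ j ∈ T', v j) s := by
    rw [sum_inner, ← hK, ← nsmul_eq_mul]
    exact card_nsmul_le_sum _ _ _ fun j _ => hvs j
  have h4 := hvs i
  have hM' : (0 : ℝ) < M := by exact_mod_cast hM
  set z := ∑ j ∈ T', v j
  have h0 := real_inner_self_nonneg (x := (M : ℝ) • (v i + t • z) - (1 + t * K) • s)
  have c1 := real_inner_comm (v i) z
  have c2 := real_inner_comm (v i) s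
  have c3 := real_inner_comm z s
  simp only [inner_sub_left, inner_sub_right, inner_add_left, inner_add_right, inner_smul_left,
    inner_smul_right, c1, c2, c3, h1, hv.self_inner, RCLike.conj_to_real] at h0
  have hb : (0 : ℝ) < 1 + t * K := by positivity
  have e2 := mul_le_mul_of_nonneg_left h2 (by positivity : 0 ≤ (M : ℝ) ^ 2 * t ^ 2)
  have e3 := mul_le_mul_of_nonneg_left h3 (by positivity : 0 ≤ 2 * M * (1 + t * K) * t)
  have e4 := mul_le_mul_of_nonneg_left h4 (by positivity : 0 ≤ 2 * M * (1 + t * K))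
  have es := mul_le_mul_of_nonneg_left hs (by positivity : 0 ≤ (1 + t * K) ^ 2)
  have el := mul_lt_mul_of_pos_left hlarge hM'
  have : 0 ≤ (1 + t * K) ^ 2 * (M * α) := by positivity
  linarith

/-- An equiangular family with sufficiently many members can be switched so that the number of
negative inner products at each vector is bounded in terms of `α`. -/
theorem exists_switching {α : ℝ} (hα : 0 < α) (hα1 : α < 1) : ∃ N D : ℕ,
    ∀ (E : Type) [NormedAddCommGroup E] [InnerProductSpace ℝ E] (ι : Type) [Fintype ι] (v : ι → E), IsEquiangularFamily α v → N ≤ Fintype.card ι →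
      ∃ w : ι → E, IsEquiangularFamily α w ∧
        ∀ i, ∀ T : Finset ι, (∀ j ∈ T, inner ℝ (w i) (w j) = -α) → T.card < D := by
  obtain ⟨k, hk⟩ := exists_nat_gt ((1 - α) / (2 * α ^ 2))
  rw [div_lt_iff₀ (by positivity)] at hk
  have hk0 : k ≠ 0 := by rintro rfl; norm_num at hk; linarith
  -- This `t` minimizes `t²K(1 - α) - 4αtK`, with value `-2αtK`; then `K` makes the leading
  -- coefficient negative, and `M` absorbs the linear error.
  set t := 2 * α / (1 - α) with ht
  have h1α : 0 < 1 - α := by linarith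
  have htα : t * (1 - α) = 2 * α := by rw [ht]; field_simp
  have ht0 : 0 < t := by positivity
  obtain ⟨K, hK⟩ := exists_nat_gt ((1 - α) / (2 * α * t))
  rw [div_lt_iff₀ (by positivity)] at hK
  have hδ : 0 < 4 * α * t * K - t ^ 2 * K * (1 - α) - (1 - α) := by
    have : t ^ 2 * K * (1 - α) = t * K * (2 * α) := by rw [← htα]; ring
    rw [this]
    linarith
  obtain ⟨M, hM⟩ := exists_nat_gt ((1 + t * K) ^ 2 * (4 * k * α + 1) /
    (4 * α * t * K - t ^ 2 * K * (1 - α) - (1 - α)))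
  have hM0 : 0 < M := by
    have : (0 : ℝ) < M := lt_of_le_of_lt (by positivity) hM
    exact_mod_cast this
  rw [div_lt_iff₀ hδ] at hM
  obtain ⟨N, hN⟩ := exists_positive_subfamily_size hα M
  refine ⟨N, K, fun E _ _ ι _ v hv hc => ?_⟩
  obtain ⟨P, hPM, hP⟩ := hN E ι v hv hc
  choose w hw hws using hv.exists_sign hα hα1 hP hk0 (by linarith)
  have hs := inner_sum_sum_le hv.self_inner (c := α) (T := P) fun i hi j hj hij => (hP hi hj hij).le
  rw [hPM] at hs hws
  have hw' := hv.of_sign hw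
  exact ⟨w, hw', fun i T hT => hw'.negative_card_lt hα hM0 hs hws ht0.le hM i hT⟩

end IsEquiangularFamily

end Switching

/-! ### From the Gram matrix to the eigenspace -/

namespace IsEquiangularFamily

open Matrix Finset

variable {E : Type*} [NormedAddCommGroup E] [InnerProductSpace ℝ E] {ι : Type*} {α : ℝ}

/-- The graph of negative inner products, with a loop at every vertex. -/
def _root_.negativeGraph (α : ℝ) (v : ι → E) : Matrix ι ι ℝ := by
  classical exact fun i j => if i = j ∨ inner ℝ (v i) (v j) = -α then 1 else 0

theorem isLoopedAdj_negativeGraph (v : ι → E) : IsLoopedAdj (negativeGraph α v) where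
  symm := by
    ext i j
    classical
    exact if_congr (or_congr eq_comm (by rw [real_inner_comm])) rfl rfl
  entry i j := by
    unfold negativeGraph
    split_ifs <;> simp
  diag i := by simp [negativeGraph]

variable {v : ι → E}

theorem inner_eq_negativeGraph [DecidableEq ι] (hv : IsEquiangularFamily α v) (hα : 0 < α)
    (i j : ι) :
    inner ℝ (v i) (v j) = (1 + α) * (if i = j then 1 else 0) + α -
      2 * α * negativeGraph α v i j := by
  by_cases h : i = j
  · subst h
    rw [hv.self_inner i]
    simp [negativeGraph]
    ring
  · rcases hv.pair_inner i j h with h' | h'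
    · have : α ≠ -α := by linarith
      simp [negativeGraph, h, h', this]
    · simp [negativeGraph, h, h']
      ring

variable [Fintype ι]

theorem inner_sum_smul (hv : IsEquiangularFamily α v) (hα : 0 < α) (f : ι → ℝ) (i : ι) :
    inner ℝ (v i) (∑ j, f j • v j) =
      (1 + α) * f i + α * ∑ j, f j - 2 * α * (negativeGraph α v *ᵥ f) i := by
  classical
  simp only [inner_sum, inner_smul_right, hv.inner_eq_negativeGraph hα, Matrix.mulVec, dotProduct,
    mul_sum]
  have : (1 + α) * f i = ∑ j, f j * ((1 + α) * if i = j then 1 else 0) := by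
    simp [mul_comm]
  rw [this, ← sum_add_distrib, ← sum_sub_distrib]
  exact sum_congr rfl fun j _ => by ring

theorem form_negativeGraph_le (hv : IsEquiangularFamily α v) (hα : 0 < α) {f : ι → ℝ}
    (hf : ∑ i, f i = 0) :
    f ⬝ᵥ negativeGraph α v *ᵥ f ≤ (1 + α) / (2 * α) * (f ⬝ᵥ f) := by
  have h0 := real_inner_self_nonneg (x := ∑ j, f j • v j)
  have h1 : inner ℝ (∑ j, f j • v j) (∑ j, f j • v j) =
      (1 + α) * (f ⬝ᵥ f) - 2 * α * (f ⬝ᵥ negativeGraph α v *ᵥ f) := by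
    rw [sum_inner]
    simp only [inner_smul_left, hv.inner_sum_smul hα, hf, dotProduct, mul_sum,
      RCLike.conj_to_real, ← sum_sub_distrib]
    exact sum_congr rfl fun j _ => by ring
  rw [h1] at h0
  rw [div_mul_eq_mul_div, le_div_iff₀ (by positivity)]
  linarith

/-- Relations among the vectors with coordinate sum zero: the sum costs one dimension, the relation
at most `dim E`. -/
theorem card_le_finrank_add [FiniteDimensional ℝ E] (v : ι → E) :
    Fintype.card ι ≤ 1 + Module.finrank ℝ E + Module.finrank ℝ
      (LinearMap.ker ((Fintype.linearCombination ℝ (fun _ : ι => (1 : ℝ))).prod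
        (Fintype.linearCombination ℝ v))) := by
  have h := (⊤ : Submodule ℝ (ι → ℝ)).finrank_le_finrank_add_inf_ker
    ((Fintype.linearCombination ℝ (fun _ : ι => (1 : ℝ))).prod (Fintype.linearCombination ℝ v))
  rw [finrank_top, top_inf_eq, Module.finrank_prod, Module.finrank_self,
    Module.finrank_fintype_fun_eq_card] at h
  exact h

/-- The number of equiangular lines with angle `arccos α` is at most
`(1 + 1 / λ + o(1)) n`, in terms of `μ = λ + 1 = (1 + α) / (2 α)`. -/
theorem exists_card_le {α : ℝ} (hα : 0 < α) (hα1 : α < 1) {ε : ℝ} (hε : 0 < ε) :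
    ∃ C : ℝ, ∀ (E : Type) [NormedAddCommGroup E] [InnerProductSpace ℝ E] [FiniteDimensional ℝ E]
      (ι : Type) [Fintype ι] (v : ι → E), IsEquiangularFamily α v →
        (Fintype.card ι : ℝ) ≤ Module.finrank ℝ E + Fintype.card ι / ((1 + α) / (2 * α)) +
          ε * Fintype.card ι + C := by
  classical
  have hμ : 1 < (1 + α) / (2 * α) := by
    rw [lt_div_iff₀ (by positivity)]
    linarith
  obtain ⟨N, D, hND⟩ := exists_switching hα hα1
  obtain ⟨C, hC⟩ := exists_finrank_eigenspace_le hμ (D + 1) hε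
  -- `N` covers families too small to switch; the extra 1 pays for the condition of sum zero.
  refine ⟨max N (C + 1), fun E _ _ _ ι _ v hv => ?_⟩
  have hnn : (0 : ℝ) ≤ Fintype.card ι / ((1 + α) / (2 * α)) + ε * Fintype.card ι := by positivity
  rcases le_total N (Fintype.card ι) with hN | hN
  · obtain ⟨w, hw, hwD⟩ := hND E ι v hv hN
    have h1 := card_le_finrank_add w
    have h2 := hC ι (negativeGraph α w) (isLoopedAdj_negativeGraph w) (fun i => by
      have h3 := hwD i (univ.filter fun j => inner ℝ (w i) (w j) = -α) (by simp)
      have h4 : (univ.filter fun j => i = j ∨ inner ℝ (w i) (w j) = -α).card ≤ D + 1 := by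
        rw [filter_or]
        refine (card_union_le _ _).trans ?_
        rw [filter_eq, if_pos (mem_univ i), card_singleton]
        omega
      simp only [negativeGraph, sum_boole]
      exact_mod_cast h4) (fun f hf => hw.form_negativeGraph_le hα hf)
      (LinearMap.ker ((Fintype.linearCombination ℝ (fun _ : ι => (1 : ℝ))).prod
        (Fintype.linearCombination ℝ w))) (fun f hf => by
      have hf1 : ∑ i, f i = 0 := by
        simpa [Fintype.linearCombination_apply] using congrArg Prod.fst (LinearMap.mem_ker.1 hf)
      have hf2 : ∑ i, f i • w i = 0 := congrArg Prod.snd (LinearMap.mem_ker.1 hf)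
      ext i
      have h3 := hw.inner_sum_smul hα f i
      rw [hf1, hf2, inner_zero_right] at h3
      rw [Pi.smul_apply, smul_eq_mul, div_mul_eq_mul_div, eq_div_iff (by positivity)]
      linarith)
    have h1' : (Fintype.card ι : ℝ) ≤ 1 + Module.finrank ℝ E + Module.finrank ℝ
        (LinearMap.ker ((Fintype.linearCombination ℝ (fun _ : ι => (1 : ℝ))).prod
          (Fintype.linearCombination ℝ w))) := by exact_mod_cast h1
    have := le_max_right (N : ℝ) (C + 1)
    linarith
  · have h1 : (Fintype.card ι : ℝ) ≤ N := by exact_mod_cast hN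
    have := le_max_left (N : ℝ) (C + 1)
    have : (0 : ℝ) ≤ Module.finrank ℝ E := Nat.cast_nonneg _
    linarith

end IsEquiangularFamily

/-! ### Equiangular lines and the asymptotic bound -/

/-- Unit direction vectors of equiangular lines. -/
theorem IsEquiangular.exists_family {α : ℝ} (hα : 0 < α) (hα1 : α < 1) {n : ℕ}
    {S : Finset (Projectivization ℝ (EuclideanSpace ℝ (Fin n)))}
    (hS : IsEquiangular α (S : Set (Projectivization ℝ (EuclideanSpace ℝ (Fin n))))) :
    ∃ v : S → EuclideanSpace ℝ (Fin n), IsEquiangularFamily α v := by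
  have hn : ∀ L : S, ‖L.1.rep‖ ≠ 0 := fun L => norm_ne_zero_iff.2 L.1.rep_nonzero
  refine ⟨fun L => ‖L.1.rep‖⁻¹ • L.1.rep, fun L => ?_, fun L M hLM => ?_⟩
  · rw [inner_smul_left, inner_smul_right, real_inner_self_eq_norm_mul_norm]
    have := hn L
    simp only [RCLike.conj_to_real]
    field_simp
  · have h : lineAngle L.1 M.1 = Real.arccos α := hS L.2 M.2 fun h => hLM (Subtype.ext h)
    have hc : inner ℝ (‖L.1.rep‖⁻¹ • L.1.rep) (‖M.1.rep‖⁻¹ • M.1.rep) =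
        Real.cos (InnerProductGeometry.angle L.1.rep M.1.rep) := by
      rw [InnerProductGeometry.cos_angle, inner_smul_left, inner_smul_right]
      have := hn L
      have := hn M
      simp only [RCLike.conj_to_real]
      field_simp
    have hcos := Real.cos_arccos (x := α) (by linarith) hα1.le
    rw [hc]
    unfold lineAngle at h
    rcases min_choice (InnerProductGeometry.angle L.1.rep M.1.rep)
      (Real.pi - InnerProductGeometry.angle L.1.rep M.1.rep) with h' | h' <;> rw [h'] at h
    · exact Or.inl (by rw [h, hcos])
    · right
      rw [← hcos, ← h, Real.cos_pi_sub, neg_neg]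

/-- Each `δ > 0` gives a linear bound `(1 + 1 / λ + δ) n + C` on the number of equiangular lines. -/
theorem exists_equiangularSizes_le {α lam : ℝ} (hα : 0 < α) (hα1 : α < 1)
    (hlam : lam = (1 - α) / (2 * α)) {δ : ℝ} (hδ : 0 < δ) :
    ∃ C : ℝ, ∀ n : ℕ, ∀ k ∈ equiangularSizes α n, (k : ℝ) ≤ (1 + 1 / lam + δ) * n + C := by
  have hl : 0 < lam := by
    rw [hlam]
    exact div_pos (by linarith) (by linarith)
  set b := 1 + 1 / lam + δ with hb
  have hb0 : 0 < b := by positivity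
  have hμ : (1 + α) / (2 * α) = lam + 1 := by
    rw [hlam]
    field_simp
    ring
  -- With this `ε` the coefficient `1 - 1 / (lam + 1) - ε` of the number of lines is exactly `1 /
  -- b`.
  have hε : 0 < lam / (lam + 1) - 1 / b := by
    rw [sub_pos, div_lt_div_iff₀ hb0 (by linarith)]
    have : lam * b = lam + 1 + lam * δ := by rw [hb]; field_simp
    have := mul_pos hl hδ
    linarith
  obtain ⟨C, hC⟩ := IsEquiangularFamily.exists_card_le hα hα1 hε
  refine ⟨b * C, fun n k hk => ?_⟩
  obtain ⟨S, hS, rfl⟩ := hk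
  obtain ⟨v, hv⟩ := hS.exists_family hα hα1
  have h := hC _ _ v hv
  rw [hμ, finrank_euclideanSpace_fin, Fintype.card_coe] at h
  have h1 : (S.card : ℝ) / (lam + 1) + (lam / (lam + 1) - 1 / b) * S.card =
      S.card - S.card / b := by
    field_simp
    ring
  have h2 : (S.card : ℝ) / b ≤ n + C := by linarith
  rw [div_le_iff₀ hb0] at h2
  linarith

theorem isGreatest_maxEquiangular {α : ℝ} (hα : 0 < α) (hα1 : α < 1) (n : ℕ) :
    IsGreatest (equiangularSizes α n) (maxEquiangular α n) := by
  obtain ⟨C, hC⟩ := exists_equiangularSizes_le hα hα1 rfl one_pos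
  have hne : (equiangularSizes α n).Nonempty := ⟨0, ∅, by simp [IsEquiangular], rfl⟩
  have hbdd : BddAbove (equiangularSizes α n) := by
    obtain ⟨B, hB⟩ := exists_nat_ge ((1 + 1 / ((1 - α) / (2 * α)) + 1) * n + C)
    exact ⟨B, fun k hk => by exact_mod_cast (hC n k hk).trans hB⟩
  exact ⟨Nat.sSup_mem hne hbdd, fun k hk => le_csSup hbdd hk⟩

theorem maxEquiangular_zero {α : ℝ} (hα : 0 < α) (hα1 : α < 1) : maxEquiangular α 0 = 0 := by
  obtain ⟨S, -, hS⟩ := (isGreatest_maxEquiangular hα hα1 0).1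
  rw [← hS, Finset.card_eq_zero]
  exact Finset.eq_empty_of_forall_notMem fun L _ => L.rep_nonzero (Subsingleton.elim _ _)

theorem exists_error_maxEquiangular {α lam : ℝ} (hα : 0 < α) (hα1 : α < 1)
    (hlam : lam = (1 - α) / (2 * α)) :
    ∃ err : ℕ → ℝ, Asymptotics.IsLittleO Filter.atTop err (fun _ : ℕ => (1 : ℝ)) ∧
      ∀ n : ℕ, (maxEquiangular α n : ℝ) ≤ (1 + 1 / 4 + 1 / lam ^ 2 + err n) * n := by
  have hl : 0 < lam := by
    rw [hlam]
    exact div_pos (by linarith) (by linarith)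
  set b := 1 + 1 / 4 + 1 / lam ^ 2 with hb
  -- AM-GM for `1 / lam` and `1 / 2`.
  have hlb : 1 + 1 / lam ≤ b := by
    have h1 : 0 ≤ (1 / lam - 1 / 2) ^ 2 := sq_nonneg _
    have h2 : (1 / lam) ^ 2 = 1 / lam ^ 2 := by rw [div_pow, one_pow]
    linarith
  -- The error is the excess of the ratio over `b`, truncated at 0. At `n = 0` the ratio carries no
  -- information, and the bound holds because there are no lines.
  refine ⟨fun n => max 0 (maxEquiangular α n / n - b), ?_, fun n => ?_⟩
  · rw [Asymptotics.isLittleO_one_iff, Metric.tendsto_atTop]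
    intro ε hε
    obtain ⟨C, hC⟩ := exists_equiangularSizes_le hα hα1 hlam (half_pos hε)
    obtain ⟨N, hN⟩ := exists_nat_gt (C / (ε / 2))
    refine ⟨N + 1, fun n hn => ?_⟩
    have hNn : (N : ℝ) < n := by exact_mod_cast hn
    have hn0 : (0 : ℝ) < n := (Nat.cast_nonneg N).trans_lt hNn
    have h1 := hC n _ (isGreatest_maxEquiangular hα hα1 n).1
    have h2 : C < n * (ε / 2) := (div_lt_iff₀ (half_pos hε)).1 (hN.trans hNn)
    rw [Real.dist_0_eq_abs, abs_of_nonneg (le_max_left _ _), max_lt_iff]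
    refine ⟨hε, ?_⟩
    rw [sub_lt_iff_lt_add, div_lt_iff₀ hn0]
    have h3 := mul_le_mul_of_nonneg_right hlb hn0.le
    linarith
  · rcases Nat.eq_zero_or_pos n with rfl | hn
    · simp [maxEquiangular_zero hα hα1]
    · have hn0 : (0 : ℝ) < n := by exact_mod_cast hn
      rw [← div_le_iff₀ hn0]
      have := le_max_right 0 ((maxEquiangular α n : ℝ) / n - b)
      linarith

theorem mainTheorem3 :
    (∀ α lam : ℝ, 0 < α → α < 1 → lam = (1 - α) / (2 * α) → 2 ≤ lam →
      (∀ n : ℕ, IsGreatest (equiangularSizes α n) (maxEquiangular α n)) ∧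
      ∃ err : ℕ → ℝ, Asymptotics.IsLittleO Filter.atTop err (fun _ : ℕ => (1 : ℝ)) ∧
        ∀ n : ℕ, (maxEquiangular α n : ℝ) ≤ (1 + 1 / 4 + 1 / lam ^ 2 + err n) * (n : ℝ)) ∧
    ((∀ n : ℕ, IsGreatest (equiangularSizes (1 / 7) n) (maxEquiangular (1 / 7) n)) ∧
      ∃ err : ℕ → ℝ, Asymptotics.IsLittleO Filter.atTop err (fun _ : ℕ => (1 : ℝ)) ∧
        ∀ n : ℕ, (maxEquiangular (1 / 7) n : ℝ) ≤ (4 / 3 + 1 / 36 + err n) * (n : ℝ)) := by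
  refine ⟨fun α lam hα hα1 hlam _ => ⟨isGreatest_maxEquiangular hα hα1,
    exists_error_maxEquiangular hα hα1 hlam⟩,
    isGreatest_maxEquiangular (by norm_num) (by norm_num), ?_⟩
  -- Here `λ = 3`, and `1 + 1/4 + 1/9 = 49/36 = 4/3 + 1/36`.
  obtain ⟨err, h1, h2⟩ := exists_error_maxEquiangular (α := 1 / 7) (lam := 3)
    (by norm_num) (by norm_num) (by norm_num)
  refine ⟨err, h1, fun n => (h2 n).trans (le_of_eq ?_)⟩
  norm_num

end
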